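/- Let $\mathfrak g$ be a finite-dimensional simple complex Lie algebra, $\mathfrak h$ a Cartan subalgebra, $R$ the root system of $(\mathfrak g,\mathfrak h)$ with root spaces $\mathfrak g^{\alpha}$, and $S=\{\alpha_1,\dots,\alpha_l\}$ a base of simple roots. For each $j$ let $H_j\in\mathfrak h$ be the coroot of $\alpha_j$, and choose $X_j^{\pm}\in\mathfrak g^{\pm\alpha_j}$ with $[X_j^+,X_j^-]=H_j$. Fix $d\in\{1,\dots,l\}$ and let $\mathfrak g_d$ be the Lie subalgebra of $\mathfrak g$ generated by all $H_j,X_j^+,X_j^-$ with $j\neq d$. For a root $\alpha=\sum_j k_j\alpha_j$ put $\operatorname{mult}_d(\alpha)=k_d$, and for $i\in\mathbb Z$ let $$\mathfrak g_{[i]}=\bigoplus_{\alpha\in R,\ \operatorname{mult}_d(\alpha)=i}\mathfrak g^{\alpha}\quad(i\neq 0),\qquad \mathfrak g_{[0]}=\mathfrak h\oplus\bigoplus_{\alpha\in R,\ \operatorname{mult}_d(\alpha)=0}\mathfrak g^{\alpha},$$ each regarded as a $\mathfrak g_d$-module under the bracket of $\mathfrak g$. Then: 1. for every $i\neq 0$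 with $\mathfrak g_{[i]}\neq 0$, the $\mathfrak g_d$-module $\mathfrak g_{[i]}$ is irreducible; 2. $\mathfrak g_{[0]}=\mathfrak g_d\oplus Z$ for some $\mathfrak g_d$-submodule $Z$ of $\mathfrak g$ isomorphic to the one-dimensional trivial module $\mathbb C$; that is, $\mathfrak g_{[0]}=\mathfrak g_d\oplus\mathbb C$ as $\mathfrak g_d$-modules. -/

import Mathlib

open LieAlgebra LieAlgebra.IsKilling LieModule

noncomputable section

namespace RootGrading

variable {L : Type*} [LieRing L] [LieAlgebra ℂ L] [FiniteDimensional ℂ L] [IsKilling ℂ L]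
  {H : LieSubalgebra ℂ L} [H.IsCartanSubalgebra]

/-- Weyl generators of `L` for the base `b` of simple roots: vectors `X_i⁺ ∈ L^{α_i}` and
`X_i⁻ ∈ L^{-α_i}` with `[X_i⁺, X_i⁻] = H_i`, where `H_i` is the coroot of the simple root `α_i`. -/
structure WeylGenerators (b : (rootSystem H).Base) where
  /-- The vectors `X_i⁺`. -/
  Xp : b.support → L
  /-- The vectors `X_i⁻`. -/
  Xm : b.support → L
  Xp_mem (i : b.support) : Xp i ∈ rootSpace H ((i : H.root) : Weight ℂ H L)
  Xm_mem (i : b.support) : Xm i ∈ rootSpace H (-(((i : H.root) : Weight ℂ H L) : H → ℂ))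
  lie_Xp_Xm (i : b.support) : ⁅Xp i, Xm i⁆ = (coroot ((i : H.root) : Weight ℂ H L) : L)

variable {b : (rootSystem H).Base}

/-- The generator `H_i`: the coroot of the simple root `α_i`. -/
def WeylGenerators.Hgen (_X : WeylGenerators b) (i : b.support) : L :=
  (coroot ((i : H.root) : Weight ℂ H L) : L)

/-- The subalgebra `L_d` of `L` generated by all `H_i, X_i⁺, X_i⁻` with `i ≠ d`. -/
def deletion (X : WeylGenerators b) (d : b.support) : LieSubalgebra ℂ L :=
  LieSubalgebra.lieSpan ℂ L
    {x | ∃ i : b.support, i ≠ d ∧ (x = X.Hgen i ∨ x = X.Xp i ∨ x = X.Xm i)}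

/-- The multiplicity of the simple root `α_d` in the root `α`: the integer `k_d`, where
`α = ∑ k_i α_i`. -/
def mult (b : (rootSystem H).Base) (d : b.support) (α : H.root) : ℤ :=
  b.toWeightBasisInt.repr ((rootSystem H).rootSpanMem ℤ α) d

/-- `x` is homogeneous of degree `i` for the `α_d`-multiplicity: it is a vector of a root space
`L^α` with `mult_d α = i`, or `i = 0` and it lies in the Cartan subalgebra. -/
def IsHomogeneous (b : (rootSystem H).Base) (d : b.support) (i : ℤ) (x : L) : Prop :=
  (∃ α : H.root, mult b d α = i ∧ x ∈ rootSpace H (α : Weight ℂ H L)) ∨ (i = 0 ∧ x ∈ H)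

/-- The linear span of the homogeneous elements of degree `i`. -/
def pieceSpan (b : (rootSystem H).Base) (d : b.support) (i : ℤ) : Submodule ℂ L :=
  Submodule.span ℂ {x | IsHomogeneous b d i x}

lemma mult_add {d : b.support} {α β γ : H.root}
    (h : ((γ : Weight ℂ H L) : H → ℂ) = (α : Weight ℂ H L) + (β : Weight ℂ H L)) :
    mult b d γ = mult b d α + mult b d β := by
  have : (rootSystem H).rootSpanMem ℤ γ =
      (rootSystem H).rootSpanMem ℤ α + (rootSystem H).rootSpanMem ℤ β := by
    apply Subtype.ext
    ext x
    exact congrFun h x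
  rw [mult, this, map_add]
  rfl

lemma mult_add_eq_zero {d : b.support} {α β : H.root}
    (h : ((α : Weight ℂ H L) : H → ℂ) + (β : Weight ℂ H L) = 0) :
    mult b d α + mult b d β = 0 := by
  have : (rootSystem H).rootSpanMem ℤ α + (rootSystem H).rootSpanMem ℤ β = 0 := by
    apply Subtype.ext
    ext x
    exact congrFun h x
  rw [mult, mult, ← Finsupp.add_apply, ← map_add, this, LinearEquiv.map_zero]
  rfl

lemma mult_simple_of_ne {d i : b.support} (h : i ≠ d) : mult b d i = 0 := by
  have : (rootSystem H).rootSpanMem ℤ i = b.toWeightBasisInt i := by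
    apply Subtype.ext
    simp
  simp [mult, this, h]

lemma IsHomogeneous.lie {d : b.support} {i j : ℤ} {x y : L}
    (hx : IsHomogeneous b d i x) (hy : IsHomogeneous b d j y) :
    ⁅x, y⁆ ∈ pieceSpan b d (i + j) := by
  rcases hx with ⟨α, hα, hx⟩ | ⟨rfl, hx⟩ <;> rcases hy with ⟨β, hβ, hy⟩ | ⟨rfl, hy⟩
  · have hm : ⁅x, y⁆ ∈ rootSpace H (((α : Weight ℂ H L) : H → ℂ) + (β : Weight ℂ H L)) :=
      lie_mem_genWeightSpace_of_mem_genWeightSpace hx hy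
    by_cases h0 : ((α : Weight ℂ H L) : H → ℂ) + (β : Weight ℂ H L) = 0
    · refine Submodule.subset_span (Or.inr ⟨hα ▸ hβ ▸ mult_add_eq_zero h0, ?_⟩)
      rw [h0, rootSpace_zero_eq ℂ L H] at hm
      exact hm
    · by_cases hb : rootSpace H (((α : Weight ℂ H L) : H → ℂ) + (β : Weight ℂ H L)) = ⊥
      · rw [hb] at hm
        rw [(LieSubmodule.mem_bot _).1 hm]
        exact zero_mem _
      · let γ : Weight ℂ H L := ⟨_, hb⟩
        have hγ : γ ∈ H.root := by
          simp only [LieSubalgebra.root, Finset.mem_filter, Finset.mem_univ, true_and]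
          exact h0
        exact Submodule.subset_span (Or.inl ⟨⟨γ, hγ⟩, hα ▸ hβ ▸ mult_add rfl, hm⟩)
  · refine Submodule.subset_span (Or.inl ⟨α, by simpa using hα, ?_⟩)
    rw [← lie_skew]
    exact neg_mem ((rootSpace H (α : Weight ℂ H L)).lie_mem (x := ⟨y, hy⟩) hx)
  · exact Submodule.subset_span (Or.inl ⟨β, by simpa using hβ,
      (rootSpace H (β : Weight ℂ H L)).lie_mem (x := ⟨x, hx⟩) hy⟩)
  · exact Submodule.subset_span (Or.inr ⟨by simp, H.lie_mem hx hy⟩)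

lemma lie_mem_pieceSpan {d : b.support} {i j : ℤ} {x y : L}
    (hx : x ∈ pieceSpan b d i) (hy : y ∈ pieceSpan b d j) :
    ⁅x, y⁆ ∈ pieceSpan b d (i + j) := by
  induction hx using Submodule.span_induction with
  | mem x hx =>
    induction hy using Submodule.span_induction with
    | mem y hy => exact IsHomogeneous.lie hx hy
    | zero => simp
    | add u v _ _ hu hv => rw [lie_add]; exact add_mem hu hv
    | smul t u _ hu => rw [lie_smul]; exact Submodule.smul_mem _ t hu
  | zero => simp
  | add u v _ _ hu hv => rw [add_lie]; exact add_mem hu hv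
  | smul t u _ hu => rw [smul_lie]; exact Submodule.smul_mem _ t hu

lemma mem_pieceSpan_zero_of_mem_deletion {X : WeylGenerators b} {d : b.support} {x : L}
    (hx : x ∈ deletion X d) : x ∈ pieceSpan b d 0 := by
  induction hx using LieSubalgebra.lieSpan_induction with
  | mem x h =>
    obtain ⟨i, hi, rfl | rfl | rfl⟩ := h
    · exact Submodule.subset_span (Or.inr ⟨rfl, SetLike.coe_mem _⟩)
    · exact Submodule.subset_span (Or.inl ⟨i, mult_simple_of_ne hi, X.Xp_mem i⟩)
    · let w : Weight ℂ H L := -((i : H.root) : Weight ℂ H L)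
      have hw : w ∈ H.root := by
        simpa [w] using ((i : H.root) : Weight ℂ H L).isNonZero_neg.2
          (LieSubalgebra.isNonZero_coe_root (i : H.root))
      refine Submodule.subset_span (Or.inl ⟨⟨w, hw⟩, ?_, X.Xm_mem i⟩)
      have := mult_add_eq_zero (b := b) (d := d) (α := ⟨w, hw⟩) (β := i) (by simp [w])
      rwa [mult_simple_of_ne hi, add_zero] at this
  | zero => exact zero_mem _
  | add u v _ _ hu hv => exact add_mem hu hv
  | smul t u _ hu => exact Submodule.smul_mem _ t hu
  | lie u v _ _ hu hv => simpa using lie_mem_pieceSpan hu hv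

/-- The graded piece `L_[i]` of the grading of `L` by the multiplicity of `α_d`, as an
`L_d`-module under the bracket of `L`. -/
def piece (X : WeylGenerators b) (d : b.support) (i : ℤ) :
    LieSubmodule ℂ (deletion X d) L where
  __ := pieceSpan b d i
  lie_mem {x y} hy := by
    simpa using lie_mem_pieceSpan (mem_pieceSpan_zero_of_mem_deletion x.2) hy

end RootGrading

end

/-! The fundamental coweight `ω` at `d` acts on `g_[i]` as the scalar `i`, and `ω` together with the
`H_j`, `j ≠ d`, spans `h`. Hence every `g_d`-submodule `N` of `g_[i]` is `h`-stable, and for `i ≠ 0`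
a nonzero `N` contains some root space.

Among roots of degree `i`, let `β` have least height with root space inside `N` and, if `N` is
proper, `δ` least height with root space outside. Applying `X_j^-` to `β` and `X_j^+` to `δ - α_j`
shows that neither `β - α_j` nor `δ - α_j` is a root for `j ≠ d`, so both pair nonpositively with
these `α_j`. Two such vectors with the same nonzero `d`-coordinate have positive product
(`apply_pos_of_repr_eq`), so `δ - β` is a root of degree 0. Its root space lies in `g_d`
(`rootSpace_le_deletion`) and carries that of `β` onto that of `δ` (`lie_ne_zero_of_mem_rootSpace`),
a contradiction.

In degree 0 the complement is `Z = ℂ ω`: it commutes with `g_d` and is Killing-orthogonal to it,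
while the Killing form of `ω` with itself is nonzero. -/

noncomputable section

/-! ### Obtuse bases for positive definite forms -/

namespace LinearMap.BilinForm

variable {R V ι : Type*} [CommRing R] [LinearOrder R] [IsStrictOrderedRing R]
  [AddCommGroup V] [Module R V] [Fintype ι] (B : LinearMap.BilinForm R V)

/-- A vector having nonpositive products with the members of an obtuse basis occurring in it has
nonpositive coordinates. -/
lemma repr_nonpos_of_forall_apply_nonpos (e : Module.Basis ι R V)
    (hpos : ∀ x, x ≠ 0 → 0 < B x x) (hobt : ∀ i j, i ≠ j → B (e i) (e j) ≤ 0)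
    {x : V} (hx : ∀ j, e.repr x j = 0 ∨ B x (e j) ≤ 0) (j : ι) : e.repr x j ≤ 0 := by
  -- Positive and negative parts of `x`. Their supports are disjoint, so obtuseness gives `B q p ≤
  -- 0`; then `B p p = B x p + B q p ≤ 0` forces `p = 0`.
  set p : V := ∑ j, max (e.repr x j) 0 • e j with hp
  set q : V := ∑ j, max (-e.repr x j) 0 • e j with hq
  have hxpq : x = p - q := by
    rw [hp, hq, ← Finset.sum_sub_distrib]
    conv_lhs => rw [← e.sum_repr x]
    refine Finset.sum_congr rfl fun k _ ↦ ?_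
    rw [← sub_smul]
    congr 1
    rcases le_total 0 (e.repr x k) with h | h <;> simp [h]
  have h1 : B x p ≤ 0 := by
    rw [hp, map_sum]
    refine Finset.sum_nonpos fun k _ ↦ ?_
    rw [map_smul, smul_eq_mul]
    rcases hx k with h | h
    · simp [h]
    · exact mul_nonpos_of_nonneg_of_nonpos (le_max_right _ _) h
  have h2 : B q p ≤ 0 := by
    rw [hp, hq]
    simp only [map_sum, LinearMap.sum_apply, map_smul, LinearMap.smul_apply, smul_eq_mul,
      Finset.mul_sum]
    refine Finset.sum_nonpos fun k _ ↦ Finset.sum_nonpos fun l _ ↦ ?_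
    rcases eq_or_ne l k with rfl | hlk
    · rcases le_total 0 (e.repr x l) with h | h <;> simp [h]
    · exact mul_nonpos_of_nonneg_of_nonpos (le_max_right _ _)
        (mul_nonpos_of_nonneg_of_nonpos (le_max_right _ _) (hobt _ _ hlk))
  have h3 : p = 0 := by
    by_contra h
    have := hpos p h
    rw [hxpq, map_sub, LinearMap.sub_apply] at h1
    linarith
  have h4 : e.repr p j = max (e.repr x j) 0 := by
    rw [hp, e.repr_sum_self]
  rw [h3, map_zero, Finsupp.zero_apply] at h4
  exact h4 ▸ le_max_left _ _

/-- Two vectors with the same nonzero `d`-coordinate in an obtuse basis, each having nonpositive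
products with all the other basis vectors, have positive product. -/
lemma apply_pos_of_repr_eq (e : Module.Basis ι R V) (hsymm : ∀ x y, B x y = B y x)
    (hpos : ∀ x, x ≠ 0 → 0 < B x x) (hobt : ∀ i j, i ≠ j → B (e i) (e j) ≤ 0)
    (d : ι) {x y : V} (hxy : e.repr x d = e.repr y d) (hd : e.repr x d ≠ 0)
    (hx : ∀ j ≠ d, B x (e j) ≤ 0) (hy : ∀ j ≠ d, B y (e j) ≤ 0) : 0 < B x y := by
  classical
  -- The Gram matrix with row `d` replaced by zero is singular; a kernel vector gives `w` orthogonal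
  -- to all `e j`, `j ≠ d`.
  obtain ⟨w, hw, hwe⟩ : ∃ w : V, w ≠ 0 ∧ ∀ j ≠ d, B w (e j) = 0 := by
    let G : Matrix ι ι R := .of fun j k ↦ if j = d then 0 else B (e j) (e k)
    have hdet : G.det = 0 := Matrix.det_eq_zero_of_row_eq_zero d fun k ↦ by simp [G]
    obtain ⟨v, hv, hGv⟩ := Matrix.exists_mulVec_eq_zero_iff.2 hdet
    refine ⟨∑ k, v k • e k, fun h ↦ hv ?_, fun j hj ↦ ?_⟩
    · ext k
      have := e.repr_sum_self v
      rw [h, map_zero] at this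
      exact (congrFun this k).symm
    · have := congrFun hGv j
      simp only [Matrix.mulVec, dotProduct, G, Matrix.of_apply, hj, if_false, Pi.zero_apply] at this
      rw [hsymm, ← this]
      simp [mul_comm]
  set m := e.repr w d with hm
  set i := e.repr x d with hi
  have hwv (v : V) : B w v = e.repr v d * B w (e d) := by
    conv_lhs => rw [← e.sum_repr v]
    simp only [map_sum, map_smul, smul_eq_mul]
    exact Finset.sum_eq_single d (fun k _ hk ↦ by simp [hwe k hk]) (by simp)
  have hww : 0 < B w w := hpos w hw
  have hm0 : m ≠ 0 := fun h ↦ by rw [hwv, ← hm, h, zero_mul] at hww; exact hww.ne rfl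
  -- Subtracting a multiple of `w` kills the `d`-coordinate without changing the signs of the other
  -- products. Scaling by the square `m * m` avoids division and preserves inequalities.
  have key (v : V) (hv : e.repr v d = i) (hvj : ∀ j ≠ d, B v (e j) ≤ 0) :
      e.repr ((m * m) • v - (i * m) • w) d = 0 ∧
      (∀ j ≠ d, B ((m * m) • v - (i * m) • w) (e j) ≤ 0) := by
    refine ⟨?_, fun j hj ↦ ?_⟩
    · simp [hv, ← hm]; ring
    · simp only [map_sub, map_smul, LinearMap.sub_apply, LinearMap.smul_apply, smul_eq_mul,
        hwe j hj, mul_zero, sub_zero]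
      exact mul_nonpos_of_nonneg_of_nonpos (mul_self_nonneg m) (hvj j hj)
  obtain ⟨hx0, hx'⟩ := key x rfl hx
  obtain ⟨hy0, hy'⟩ := key y hxy.symm hy
  set x' := (m * m) • x - (i * m) • w with hxdef
  set y' := (m * m) • y - (i * m) • w with hydef
  have hxn := B.repr_nonpos_of_forall_apply_nonpos e hpos hobt (x := x') fun j ↦ by
    rcases eq_or_ne j d with rfl | hj
    · exact .inl hx0
    · exact .inr (hx' j hj)
  have hxy' : 0 ≤ B x' y' := by
    conv_rhs => rw [← e.sum_repr x']
    simp only [map_sum, LinearMap.sum_apply, map_smul, LinearMap.smul_apply, smul_eq_mul]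
    refine Finset.sum_nonneg fun j _ ↦ ?_
    rcases eq_or_ne j d with rfl | hj
    · simp [hx0]
    · exact mul_nonneg_of_nonpos_of_nonpos (hxn j) (hsymm y' _ ▸ hy' j hj)
  have hwx : B w x' = 0 := by rw [hwv, hx0, zero_mul]
  have hwy : B w y' = 0 := by rw [hwv, hy0, zero_mul]
  have hx2 : (m * m) • x = x' + (i * m) • w := by rw [hxdef]; abel
  have hy2 : (m * m) • y = y' + (i * m) • w := by rw [hydef]; abel
  -- As `w` is orthogonal to `x'` and `y'`, only `B x' y' ≥ 0` and a positive multiple of `B w w`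
  -- survive.
  have hfin : (m * m) * ((m * m) * B x y) = B x' y' + (i * m) * ((i * m) * B w w) := by
    have : B ((m * m) • x) ((m * m) • y) = B (x' + (i * m) • w) (y' + (i * m) • w) := by
      rw [hx2, hy2]
    simpa [hwy, hsymm x' w, hwx] using this
  have him : i * m ≠ 0 := mul_ne_zero hd hm0
  have hpos' : 0 < (m * m) * ((m * m) * B x y) := by
    rw [hfin]
    have : 0 < (i * m) * (i * m) := mul_self_pos.2 him
    nlinarith [mul_pos this hww]
  have hmm : 0 < m * m := mul_self_pos.2 hm0
  exact (mul_pos_iff_of_pos_left hmm).1 ((mul_pos_iff_of_pos_left hmm).1 hpos')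

end LinearMap.BilinForm

/-! ### Positive pairings between roots -/

namespace RootPairing

variable {ι R M N : Type*} [Finite ι] [CommRing R] [CharZero R] [IsDomain R]
  [AddCommGroup M] [Module R M] [AddCommGroup N] [Module R N]
  {P : RootPairing ι R M N} [P.IsCrystallographic]

lemma Base.pairingIn_pos_of_repr_eq (b : P.Base) (d : b.support) {i j : ι}
    (hij : b.toWeightBasisInt.repr (P.rootSpanMem ℤ i) d =
      b.toWeightBasisInt.repr (P.rootSpanMem ℤ j) d)
    (hd : b.toWeightBasisInt.repr (P.rootSpanMem ℤ i) d ≠ 0)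
    (hi : ∀ k : b.support, k ≠ d → P.pairingIn ℤ i k ≤ 0)
    (hj : ∀ k : b.support, k ≠ d → P.pairingIn ℤ j k ≤ 0) :
    0 < P.pairingIn ℤ i j := by
  cases nonempty_fintype ι
  have hk (k : b.support) : b.toWeightBasisInt k = P.rootSpanMem ℤ k := Subtype.ext (by simp)
  have hle (i j : ι) : (P.posRootForm ℤ).posForm (P.rootSpanMem ℤ i) (P.rootSpanMem ℤ j) ≤ 0 ↔
      P.pairingIn ℤ i j ≤ 0 := (P.posRootForm ℤ).posForm_apply_root_root_le_zero_iff i j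
  refine ((P.posRootForm ℤ).zero_lt_apply_root_root_iff i j).1
    (((P.posRootForm ℤ).posForm).apply_pos_of_repr_eq b.toWeightBasisInt
      (fun x y ↦ (P.posRootForm ℤ).isSymm_posForm.eq x y)
      (fun x hx ↦ P.posRootForm_posForm_pos_of_ne_zero ℤ hx)
      (fun k l hkl ↦ ?_) d hij hd (fun k hkd ↦ ?_) (fun k hkd ↦ ?_))
  · rw [hk, hk, hle]
    exact b.pairingIn_le_zero_of_ne (fun h ↦ hkl (Subtype.ext h)) k.2 l.2
  · rw [hk, hle]; exact hi k hkd
  · rw [hk, hle]; exact hj k hkd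

end RootPairing

end

noncomputable section

/-! ### Brackets of root vectors -/

namespace LieAlgebra.IsKilling

variable {K L : Type*} [Field K] [CharZero K] [LieRing L] [LieAlgebra K L]
  [IsKilling K L] [FiniteDimensional K L]
  {H : LieSubalgebra K L} [H.IsCartanSubalgebra] [IsTriangularizable K H L]

lemma exists_smul_eq_of_mem_rootSpace {α : Weight K H L} (hα : α.IsNonZero) {x y : L}
    (hx : x ∈ rootSpace H α) (hx0 : x ≠ 0) (hy : y ∈ rootSpace H α) : ∃ c : K, c • x = y := by
  obtain ⟨c, hc⟩ := (finrank_eq_one_iff_of_nonzero' (⟨x, hx⟩ : rootSpace H α)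
    (by simpa using hx0)).mp
    (finrank_rootSpace_eq_one α hα) ⟨y, hy⟩
  exact ⟨c, congrArg Subtype.val hc⟩

/-- A subspace meeting a root space nontrivially contains it. -/
lemma rootSpace_le_of_mem {α : Weight K H L} (hα : α.IsNonZero) {x : L}
    (hx : x ∈ rootSpace H α) (hx0 : x ≠ 0) {N : Submodule K L} (hxN : x ∈ N) :
    (rootSpace H α).toSubmodule ≤ N := fun y hy ↦ by
  obtain ⟨c, rfl⟩ := exists_smul_eq_of_mem_rootSpace hα hx hx0 hy
  exact N.smul_mem c hxN

/-- The bracket of nonzero root vectors is nonzero if the sum of the roots is a root. -/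
lemma lie_ne_zero_of_mem_rootSpace {α β : Weight K H L} (hα : α.IsNonZero) (hβ : β.IsNonZero)
    (hαβ : rootSpace H ((α : H → K) + β) ≠ ⊥) {x y : L} (hx : x ∈ rootSpace H α) (hx0 : x ≠ 0)
    (hy : y ∈ rootSpace H β) (hy0 : y ≠ 0) : ⁅x, y⁆ ≠ 0 := by
  have hp : 1 ≤ chainTopCoeff α β := by
    have := ((rootSpace_zsmul_add_ne_bot_iff α β hα 1).1 (by simpa using hαβ)).1
    exact_mod_cast this
  obtain ⟨p, hp⟩ := Nat.exists_eq_add_of_le' hp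
  -- In the `sl₂`-module generated by a top vector `t` of the `α`-string, `f ^ (p + 1)` sends `t`
  -- into the root space of `β`. Applying `e` gives `(p + 1) * (chainLength - p)` times `f ^ p` of
  -- `t`, nonzero since `p < chainLength`.
  obtain ⟨t, ht, ht0⟩ := (chainTop α β).exists_ne_zero
  obtain ⟨h, e, f, isSl2, he, hf⟩ := exists_isSl2Triple_of_weight_isNonZero hα
  obtain rfl := isSl2.h_eq_coroot hα he hf
  have prim : isSl2.HasPrimitiveVectorWith t (chainLength α β : K) :=
    have := lie_mem_genWeightSpace_of_mem_genWeightSpace he ht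
    ⟨ht0, (chainLength_smul _ _ ht).symm, by rwa [genWeightSpace_add_chainTop _ _ hα] at this⟩
  have hle : p + 1 ≤ chainLength α β := hp ▸ chainTopCoeff_le_chainLength α β
  have hmem : (toEnd K L L f ^ (p + 1)) t ∈ rootSpace H β := by
    have := toEnd_pow_apply_mem hf ht (p + 1)
    rwa [coe_chainTop', hp, smul_neg, neg_add_cancel_left] at this
  have hne : ⁅e, (toEnd K L L f ^ (p + 1)) t⁆ ≠ 0 := by
    rw [prim.lie_e_pow_succ_toEnd_f p]
    refine smul_ne_zero (mul_ne_zero (by exact_mod_cast p.succ_ne_zero) ?_)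
      (prim.pow_toEnd_f_ne_zero_of_eq_nat rfl (by lia))
    rw [sub_ne_zero]
    exact_mod_cast (show chainLength α β ≠ p by lia)
  obtain ⟨a, rfl⟩ := exists_smul_eq_of_mem_rootSpace hα hx hx0 he
  obtain ⟨c, hc⟩ := exists_smul_eq_of_mem_rootSpace hβ hy hy0 hmem
  intro h0
  rw [← hc, lie_smul, smul_lie, h0] at hne
  simp at hne

/-- A subspace containing the bracket of two nonzero root vectors contains the root space of the
sum of the two roots. -/
lemma rootSpace_le_of_lie_mem {α β γ : Weight K H L} (hα : α.IsNonZero) (hβ : β.IsNonZero)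
    (hγ : γ.IsNonZero) (h : (γ : H → K) = α + β) {x y : L} (hx : x ∈ rootSpace H α) (hx0 : x ≠ 0)
    (hy : y ∈ rootSpace H β) (hy0 : y ≠ 0) {N : Submodule K L} (hN : ⁅x, y⁆ ∈ N) :
    (rootSpace H γ).toSubmodule ≤ N :=
  rootSpace_le_of_mem hγ (h ▸ lie_mem_genWeightSpace_of_mem_genWeightSpace hx hy)
    (lie_ne_zero_of_mem_rootSpace hα hβ (h ▸ γ.genWeightSpace_ne_bot) hx hx0 hy hy0) hN

end LieAlgebra.IsKilling

/-! ### Root spaces of degree zero -/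

namespace RootGrading

variable {L : Type*} [LieRing L] [LieAlgebra ℂ L] [FiniteDimensional ℂ L] [IsKilling ℂ L]
  {H : LieSubalgebra ℂ L} [H.IsCartanSubalgebra] {b : (rootSystem H).Base}

lemma WeylGenerators.Hgen_ne_zero (X : WeylGenerators b) (i : b.support) : X.Hgen i ≠ 0 := by
  simp [WeylGenerators.Hgen]

lemma WeylGenerators.Xp_ne_zero (X : WeylGenerators b) (i : b.support) : X.Xp i ≠ 0 := fun h ↦
  X.Hgen_ne_zero i <| by rw [WeylGenerators.Hgen, ← X.lie_Xp_Xm, h, zero_lie]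

lemma WeylGenerators.Xm_ne_zero (X : WeylGenerators b) (i : b.support) : X.Xm i ≠ 0 := fun h ↦
  X.Hgen_ne_zero i <| by rw [WeylGenerators.Hgen, ← X.lie_Xp_Xm, h, lie_zero]

variable {X : WeylGenerators b} {d : b.support}

lemma Hgen_mem_deletion {i : b.support} (hi : i ≠ d) : X.Hgen i ∈ deletion X d :=
  LieSubalgebra.subset_lieSpan ⟨i, hi, .inl rfl⟩

lemma Xp_mem_deletion {i : b.support} (hi : i ≠ d) : X.Xp i ∈ deletion X d :=
  LieSubalgebra.subset_lieSpan ⟨i, hi, .inr (.inl rfl)⟩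

lemma Xm_mem_deletion {i : b.support} (hi : i ≠ d) : X.Xm i ∈ deletion X d :=
  LieSubalgebra.subset_lieSpan ⟨i, hi, .inr (.inr rfl)⟩

lemma mult_simple_self (d : b.support) : mult b d d = 1 := by
  have : (rootSystem H).rootSpanMem ℤ d = b.toWeightBasisInt d := Subtype.ext (by simp)
  simp [mult, this]

lemma mult_of_root_eq_add {α β γ : H.root}
    (h : (rootSystem H).root γ = (rootSystem H).root α + (rootSystem H).root β) :
    mult b d γ = mult b d α + mult b d β :=
  mult_add (funext fun x ↦ congr($h x))

lemma coe_of_root_eq_add {α β γ : H.root}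
    (h : (rootSystem H).root γ = (rootSystem H).root α + (rootSystem H).root β) :
    ((γ : Weight ℂ H L) : H → ℂ) = (α : Weight ℂ H L) + (β : Weight ℂ H L) :=
  funext fun x ↦ congr($h x)

/-- Induction adding one simple root at a time. Nonnegativity is carried along because it makes a
sum of degree 0 have both terms of degree 0, so `α_d` is never added and the generators `X_j^±` used
lie in the deletion. -/
lemma mult_nonneg_and_rootSpace_le_deletion (X : WeylGenerators b) (d : b.support) {α : H.root}
    (hα : b.IsPos α) : 0 ≤ mult b d α ∧ (mult b d α = 0 →
      (rootSpace H (α : Weight ℂ H L)).toSubmodule ≤ (deletion X d).toSubmodule ∧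
      (rootSpace H (-(α : Weight ℂ H L) : Weight ℂ H L)).toSubmodule ≤
        (deletion X d).toSubmodule) := by
  refine hα.induction_on_add (p := fun α ↦ 0 ≤ mult b d α ∧ (mult b d α = 0 →
      (rootSpace H (α : Weight ℂ H L)).toSubmodule ≤ (deletion X d).toSubmodule ∧
      (rootSpace H (-(α : Weight ℂ H L) : Weight ℂ H L)).toSubmodule ≤
        (deletion X d).toSubmodule)) (fun i hi ↦ ?_) (fun i j k hk hi hj ↦ ?_)
  · by_cases hid : (⟨i, hi⟩ : b.support) = d
    · subst hid
      simp [mult_simple_self (⟨i, hi⟩ : b.support)]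
    · have h0 : mult b d i = 0 := mult_simple_of_ne (i := ⟨i, hi⟩) hid
      refine ⟨h0.ge, fun _ ↦ ⟨?_, ?_⟩⟩
      · exact rootSpace_le_of_mem (LieSubalgebra.isNonZero_coe_root i) (X.Xp_mem ⟨i, hi⟩)
          (X.Xp_ne_zero _) (Xp_mem_deletion hid)
      · exact rootSpace_le_of_mem (Weight.isNonZero_neg.2 (LieSubalgebra.isNonZero_coe_root i))
          (X.Xm_mem ⟨i, hi⟩) (X.Xm_ne_zero _) (Xm_mem_deletion hid)
  · obtain ⟨hi0, hi⟩ := hi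
    have hm := mult_of_root_eq_add (d := d) hk
    have hk := coe_of_root_eq_add hk
    by_cases hjd : (⟨j, hj⟩ : b.support) = d
    · subst hjd
      have := mult_simple_self (⟨j, hj⟩ : b.support)
      simp only at this
      exact ⟨by lia, by lia⟩
    · have h0 : mult b d j = 0 := mult_simple_of_ne (i := ⟨j, hj⟩) hjd
      refine ⟨by lia, fun hk0 ↦ ?_⟩
      obtain ⟨hi1, hi2⟩ := hi (by lia)
      obtain ⟨x, hx, hx0⟩ := (i : Weight ℂ H L).exists_ne_zero
      obtain ⟨y, hy, hy0⟩ := (-(i : Weight ℂ H L)).exists_ne_zero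
      constructor
      · exact rootSpace_le_of_lie_mem (LieSubalgebra.isNonZero_coe_root i)
          (LieSubalgebra.isNonZero_coe_root j)
          (LieSubalgebra.isNonZero_coe_root k) hk hx hx0 (X.Xp_mem ⟨j, hj⟩) (X.Xp_ne_zero _)
          ((deletion X d).lie_mem (hi1 hx) (Xp_mem_deletion hjd))
      · exact rootSpace_le_of_lie_mem (Weight.isNonZero_neg.2 (LieSubalgebra.isNonZero_coe_root i))
          (β := -(j : Weight ℂ H L)) (Weight.isNonZero_neg.2 (LieSubalgebra.isNonZero_coe_root j))
          (Weight.isNonZero_neg.2 (LieSubalgebra.isNonZero_coe_root k)) (by simp [hk, add_comm]) hy hy0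
          (X.Xm_mem ⟨j, hj⟩) (X.Xm_ne_zero _)
          ((deletion X d).lie_mem (hi2 hy) (Xm_mem_deletion hjd))

lemma rootSpace_le_deletion (X : WeylGenerators b) {α : H.root} (hα : mult b d α = 0) :
    (rootSpace H (α : Weight ℂ H L)).toSubmodule ≤ (deletion X d).toSubmodule := by
  let := (rootSystem H).indexNeg
  rcases RootPairing.Base.IsPos.or_neg b α with h | h
  · exact ((mult_nonneg_and_rootSpace_le_deletion X d h).2 hα).1
  · have hneg : (((-α : H.root) : Weight ℂ H L) : H → ℂ) = -(α : Weight ℂ H L) :=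
      funext fun x ↦ congr($(((rootSystem H).root_reflectionPerm α α).trans
        ((rootSystem H).reflection_apply_self α)) x)
    have hm := mult_add_eq_zero (b := b) (d := d) (α := -α) (β := α) (by rw [hneg, neg_add_cancel])
    have := ((mult_nonneg_and_rootSpace_le_deletion X d h).2 (by lia)).2
    rwa [Weight.coe_neg, hneg, neg_neg] at this

/-! ### The fundamental coweight -/

/-- The fundamental coweight at `d`: the element of the Cartan subalgebra on which `α_d` takes the
value `1` and the other simple roots vanish. -/
def coweight (b : (rootSystem H).Base) (d : b.support) : H :=
  (Module.evalEquiv ℂ H).symm (b.toWeightBasis.coord d)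

lemma apply_coweight (f : Module.Dual ℂ H) : f (coweight b d) = b.toWeightBasis.repr f d := by
  simp [coweight]

/-- Both sides extend to `ℤ`-linear maps on the root lattice and agree on simple roots. The degree
thereby becomes an eigenvalue of the coweight. -/
lemma root_apply_coweight (α : H.root) :
    (α : Weight ℂ H L) (coweight b d) = (mult b d α : ℂ) := by
  let F : (rootSystem H).rootSpan ℤ →ₗ[ℤ] ℂ :=
    ((Module.Dual.eval ℂ H (coweight b d)).restrictScalars ℤ).comp (Submodule.subtype _)
  let G : (rootSystem H).rootSpan ℤ →ₗ[ℤ] ℂ :=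
    (Algebra.linearMap ℤ ℂ).comp (b.toWeightBasisInt.coord d)
  have hFG : F = G := b.toWeightBasisInt.ext fun i ↦ by
    have : F (b.toWeightBasisInt i) = b.toWeightBasis.repr ((rootSystem H).root i) d := by
      rw [← apply_coweight, ← b.coe_toWeightBasisInt_apply]
      rfl
    rw [this, b.toWeightBasis_repr_root]
    by_cases hid : i = d <;> simp [G, hid]
  exact congr($hFG ((rootSystem H).rootSpanMem ℤ α))

lemma coweight_lie_of_mem_pieceSpan {i : ℤ} {x : L} (hx : x ∈ pieceSpan b d i) :
    ⁅(coweight b d : L), x⁆ = (i : ℂ) • x := by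
  induction hx using Submodule.span_induction with
  | mem x hx =>
    rcases hx with ⟨α, rfl, hx⟩ | ⟨rfl, hx⟩
    · rw [← root_apply_coweight]
      exact lie_eq_smul_of_mem_rootSpace hx (coweight b d)
    · have : ⁅coweight b d, (⟨x, hx⟩ : H)⁆ = 0 := trivial_lie_zero _ _ _ _
      simpa using congrArg Subtype.val this
  | zero => simp
  | add u v _ _ hu hv => rw [lie_add, hu, hv, smul_add]
  | smul t u _ hu => rw [lie_smul, hu, smul_comm]

/-- On `H` the Killing form is the sum over roots of `α(x) α(y)`, so the value is a sum of integer
squares to which `α_d` contributes 1. -/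
lemma killingForm_coweight_self_ne_zero :
    killingForm ℂ L (coweight b d) (coweight b d) ≠ 0 := by
  have : killingForm ℂ L (coweight b d) (coweight b d) =
      ((∑ α : H.root, mult b d α * mult b d α : ℤ) : ℂ) := by
    have := congr($(corootForm_rootSystem_eq_killing (H := H)) (coweight b d) (coweight b d))
    rw [RootPairing.corootForm_apply_apply] at this
    change _ = killingForm ℂ L (coweight b d) (coweight b d) at this
    rw [← this]
    push_cast
    refine Finset.sum_congr rfl fun α _ ↦ ?_
    rw [← root_apply_coweight]
    rfl
  rw [this, Int.cast_ne_zero]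
  refine (Finset.sum_pos' (fun α _ ↦ mul_self_nonneg (mult b d α)) ⟨d, Finset.mem_univ _, ?_⟩).ne'
  simp [mult_simple_self]

lemma killingForm_coweight_Hgen {i : b.support} (hi : i ≠ d) :
    killingForm ℂ L (coweight b d) (X.Hgen i) = 0 := by
  have h0 : ⁅(coweight b d : L), X.Xp i⁆ = 0 := by
    rw [← LieSubalgebra.coe_bracket_of_module,
      lie_eq_smul_of_mem_rootSpace (X.Xp_mem i) (coweight b d), root_apply_coweight,
      mult_simple_of_ne hi, Int.cast_zero, zero_smul]
  rw [WeylGenerators.Hgen, ← X.lie_Xp_Xm, ← LieModule.traceForm_apply_lie_apply, h0]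
  simp

/-- The Cartan subalgebra is spanned by the coweight at `d` and the coroots of the simple roots
other than `α_d`. -/
lemma cartan_le_of_coweight_mem (X : WeylGenerators b) {N : Submodule ℂ L}
    (hd : (coweight b d : L) ∈ N) (hN : ∀ i ≠ d, X.Hgen i ∈ N) : H.toSubmodule ≤ N := by
  classical
  have hsum (h : H) : (h : L) = ∑ i, b.toCoweightBasis.repr h i • X.Hgen i := by
    conv_lhs => rw [← b.toCoweightBasis.sum_repr h]
    simp [WeylGenerators.Hgen]
  set c := b.toCoweightBasis.repr (coweight b d) with hc
  -- Otherwise the coweight would be a combination of the `H_i`, `i ≠ d`, all orthogonal to it,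
  -- hence isotropic. So `H_d` can be solved for.
  have hcd : c d ≠ 0 := fun h ↦ killingForm_coweight_self_ne_zero (b := b) (d := d) <| by
    nth_rw 2 [hsum (coweight b d)]
    rw [map_sum]
    refine Finset.sum_eq_zero fun i _ ↦ ?_
    rcases eq_or_ne i d with rfl | hi
    · rw [← hc, h, zero_smul, map_zero]
    · rw [map_smul, killingForm_coweight_Hgen hi, smul_zero]
  have hHd : X.Hgen d ∈ N := by
    have h1 : c d • X.Hgen d ∈ N := by
      have := hsum (coweight b d)
      rw [← Finset.add_sum_erase _ _ (Finset.mem_univ d)] at this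
      rw [eq_sub_of_add_eq this.symm]
      exact N.sub_mem hd (N.sum_mem fun i hi ↦ N.smul_mem _ (hN i (Finset.ne_of_mem_erase hi)))
    exact (N.smul_mem_iff hcd).1 h1
  intro h hh
  rw [show h = ((⟨h, hh⟩ : H) : L) from rfl, hsum]
  refine N.sum_mem fun i _ ↦ N.smul_mem _ ?_
  rcases eq_or_ne i d with rfl | hi
  exacts [hHd, hN i hi]

/-- The deletion is orthogonal to the coweight. -/
lemma killingForm_coweight_of_mem_deletion {x : L} (hx : x ∈ deletion X d) :
    killingForm ℂ L (coweight b d) x = 0 := by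
  have hz : (coweight b d : L) ∈ rootSpace H (0 : H → ℂ) := by
    rw [rootSpace_zero_eq ℂ L H]
    exact SetLike.coe_mem _
  induction hx using LieSubalgebra.lieSpan_induction with
  | mem x h =>
    obtain ⟨i, hi, rfl | rfl | rfl⟩ := h
    · exact killingForm_coweight_Hgen hi
    · refine killingForm_apply_eq_zero_of_mem_rootSpace_of_add_ne_zero ℂ L H hz (X.Xp_mem i) ?_
      rw [zero_add]
      exact LieSubalgebra.isNonZero_coe_root (i : H.root)
    · refine killingForm_apply_eq_zero_of_mem_rootSpace_of_add_ne_zero ℂ L H hz (X.Xm_mem i) ?_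
      rw [zero_add, neg_ne_zero]
      exact LieSubalgebra.isNonZero_coe_root (i : H.root)
  | zero => simp
  | add u v _ _ hu hv => rw [map_add, hu, hv, add_zero]
  | smul t u _ hu => rw [map_smul, hu, smul_zero]
  | lie u v hu' _ hu hv =>
    -- Invariance moves the bracket onto the coweight, which commutes with `u`, of degree 0.
    rw [← LieModule.traceForm_apply_lie_apply,
      coweight_lie_of_mem_pieceSpan (mem_pieceSpan_zero_of_mem_deletion hu')]
    simp

end RootGrading

end

noncomputable section

/-! ### Irreducibility in nonzero degree -/

namespace RootGrading

variable {L : Type*} [LieRing L] [LieAlgebra ℂ L] [FiniteDimensional ℂ L] [IsKilling ℂ L]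
  {H : LieSubalgebra ℂ L} [H.IsCartanSubalgebra] {b : (rootSystem H).Base}
  {X : WeylGenerators b} {d : b.support}

/-- A nonzero `H`-stable subspace of a graded piece of nonzero degree contains a root space. -/
lemma exists_rootSpace_le {i : ℤ} (hi : i ≠ 0) (N : LieSubmodule ℂ H L) (hN : N ≠ ⊥)
    (hNi : N.toSubmodule ≤ pieceSpan b d i) :
    ∃ α : H.root, mult b d α = i ∧ rootSpace H (α : Weight ℂ H L) ≤ N := by
  obtain ⟨χ, hχ⟩ : ∃ χ : Weight ℂ H L, N ⊓ genWeightSpace L χ ≠ ⊥ := by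
    by_contra! h
    apply hN
    rw [eq_bot_iff]
    have := eq_iSup_inf_genWeightSpace ℂ H L N
    simp only [h, iSup_bot] at this
    exact this.le
  obtain ⟨x, ⟨hxN, hxχ⟩, hx0⟩ : ∃ x ∈ N ⊓ genWeightSpace L χ, x ≠ 0 := by
    simpa [LieSubmodule.eq_bot_iff, and_assoc] using hχ
  -- Evaluating at the coweight recovers the degree; as `i ≠ 0`, the weight `χ` is a root.
  have hχi : χ (coweight b d) = i := by
    have h := coweight_lie_of_mem_pieceSpan (hNi hxN)
    rw [← LieSubalgebra.coe_bracket_of_module, lie_eq_smul_of_mem_rootSpace hxχ] at h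
    exact smul_left_injective ℂ hx0 h
  have hχ0 : χ.IsNonZero := fun h ↦ hi <| by
    rw [h.eq, Pi.zero_apply] at hχi
    exact_mod_cast hχi.symm
  let α : H.root := ⟨χ, by simpa using hχ0⟩
  refine ⟨α, ?_, rootSpace_le_of_mem hχ0 hxχ hx0 hxN⟩
  have := root_apply_coweight (b := b) (d := d) α
  exact_mod_cast this.symm.trans hχi

lemma root_eq_add_of_root_sub_mem {α β : H.root}
    (h : (rootSystem H).root α - (rootSystem H).root β ∈ Set.range (rootSystem H).root) :
    ∃ γ : H.root, (rootSystem H).root α = (rootSystem H).root γ + (rootSystem H).root β := by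
  obtain ⟨γ, hγ⟩ := h
  exact ⟨γ, by rw [hγ, sub_add_cancel]⟩

/-- If subtracting simple roots other than `α_d` from the root `α` never gives a root, then
`α` is antidominant for these simple roots. -/
lemma pairingIn_nonpos_of_forall_ne {α : H.root} (hα : mult b d α ≠ 0)
    (h : ∀ (j : b.support) (γ : H.root), j ≠ d →
      (rootSystem H).root α ≠ (rootSystem H).root γ + (rootSystem H).root j)
    {j : b.support} (hj : j ≠ d) : (rootSystem H).pairingIn ℤ α j ≤ 0 := by
  by_contra! hpos
  obtain ⟨γ, hγ⟩ := root_eq_add_of_root_sub_mem <|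
    (rootSystem H).root_sub_root_mem_of_pairingIn_pos hpos fun h ↦
      hα (h ▸ mult_simple_of_ne hj)
  exact h j γ hj hγ

/-- A nonzero submodule of a graded piece of nonzero degree, under the deletion and the Cartan
subalgebra, contains all root spaces of that degree. -/
lemma rootSpace_le_of_lie_stable (X : WeylGenerators b) {i : ℤ} (hi : i ≠ 0)
    (N : LieSubmodule ℂ H L) (hN : N ≠ ⊥) (hNi : N.toSubmodule ≤ pieceSpan b d i)
    (hlie : ∀ x ∈ deletion X d, ∀ y ∈ N, ⁅x, y⁆ ∈ N) {γ : H.root} (hγ : mult b d γ = i) :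
    rootSpace H (γ : Weight ℂ H L) ≤ N := by
  classical
  have hrs (α : H.root) : ∃ x ∈ rootSpace H (α : Weight ℂ H L), x ≠ 0 :=
    (α : Weight ℂ H L).exists_ne_zero
  have hlie_le {x : L} {α β γ : H.root} (hx : x ∈ rootSpace H (α : Weight ℂ H L)) (hx0 : x ≠ 0)
      (hxd : x ∈ deletion X d)
      (h : (rootSystem H).root γ = (rootSystem H).root α + (rootSystem H).root β)
      (hβ : rootSpace H (β : Weight ℂ H L) ≤ N) : rootSpace H (γ : Weight ℂ H L) ≤ N := by
    obtain ⟨y, hy, hy0⟩ := hrs β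
    exact rootSpace_le_of_lie_mem (LieSubalgebra.isNonZero_coe_root α)
      (LieSubalgebra.isNonZero_coe_root β) (LieSubalgebra.isNonZero_coe_root γ)
      (coe_of_root_eq_add h) hx hx0 hy hy0 (hlie x hxd y (hβ hy))
  obtain ⟨β, hβ, hβmin⟩ := Finset.exists_min_image
    {α : H.root | mult b d α = i ∧ rootSpace H (α : Weight ℂ H L) ≤ N} b.height <| by
      obtain ⟨α, hα⟩ := exists_rootSpace_le hi N hN hNi
      exact ⟨α, by simpa using hα⟩
  simp only [Finset.mem_filter, Finset.mem_univ, true_and] at hβ hβmin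
  by_contra hγN
  obtain ⟨δ, hδ, hδmin⟩ := Finset.exists_min_image
    {α : H.root | mult b d α = i ∧ ¬ rootSpace H (α : Weight ℂ H L) ≤ N} b.height
    ⟨γ, by simpa using ⟨hγ, hγN⟩⟩
  simp only [Finset.mem_filter, Finset.mem_univ, true_and] at hδ hδmin
  have hheight {α γ : H.root} {j : b.support}
      (h : (rootSystem H).root α = (rootSystem H).root γ + (rootSystem H).root j) :
      b.height γ < b.height α := by
    rw [b.height_add h, b.height_one_of_mem_support j.2]
    lia
  have hmult {α γ : H.root} {j : b.support} (hj : j ≠ d)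
      (h : (rootSystem H).root α = (rootSystem H).root γ + (rootSystem H).root j) :
      mult b d γ = mult b d α := by
    rw [mult_of_root_eq_add h, mult_simple_of_ne hj, add_zero]
  have hpos : 0 < (rootSystem H).pairingIn ℤ δ β := by
    refine b.pairingIn_pos_of_repr_eq d (hδ.1.trans hβ.1.symm) (fun h ↦ hi (hδ.1.symm.trans h))
      (fun j hj ↦ pairingIn_nonpos_of_forall_ne (hδ.1 ▸ hi) (fun j ε hj h ↦ hδ.2 ?_) hj)
      (fun j hj ↦ pairingIn_nonpos_of_forall_ne (hβ.1 ▸ hi) (fun j ε hj h ↦ ?_) hj)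
    -- Minimality of `δ` puts the root space of `ε = δ - α_j` in `N`, and `X_j^+` would bring it
    -- back to that of `δ`.
    · by_contra hc
      refine (hδmin ε ⟨(hmult hj h).trans hδ.1, fun hε ↦ hc ?_⟩).not_gt (hheight h)
      exact hlie_le (X.Xp_mem j) (X.Xp_ne_zero j) (Xp_mem_deletion hj) (h.trans (add_comm _ _)) hε
    -- Here `X_j^-` moves the root space of `β` to that of `ε = β - α_j`, still in `N` but of
    -- smaller height.
    · refine (hβmin ε ⟨(hmult hj h).trans hβ.1, ?_⟩).not_gt (hheight h)
      obtain ⟨y, hy, hy0⟩ := hrs β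
      exact rootSpace_le_of_lie_mem (α := -((j : H.root) : Weight ℂ H L))
        (Weight.isNonZero_neg.2 (LieSubalgebra.isNonZero_coe_root (j : H.root)))
        (LieSubalgebra.isNonZero_coe_root β) (LieSubalgebra.isNonZero_coe_root ε)
        (by simp [coe_of_root_eq_add h]) (X.Xm_mem j) (X.Xm_ne_zero j) hy hy0
        (hlie _ (Xm_mem_deletion hj) y (hβ.2 hy))
  obtain ⟨ε, hε⟩ := root_eq_add_of_root_sub_mem <|
    (rootSystem H).root_sub_root_mem_of_pairingIn_pos hpos fun h ↦ hδ.2 (h ▸ hβ.2)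
  have hε0 : mult b d ε = 0 := by
    have := mult_of_root_eq_add (d := d) hε
    lia
  obtain ⟨x, hx, hx0⟩ := hrs ε
  exact hδ.2 (hlie_le hx hx0 (rootSpace_le_deletion X hε0 hx) hε hβ.2)

lemma isIrreducible_piece (X : WeylGenerators b) (d : b.support) {i : ℤ} (hi : i ≠ 0)
    (h : piece X d i ≠ ⊥) : LieModule.IsIrreducible ℂ (deletion X d) (piece X d i) := by
  have : Nontrivial (piece X d i) := (LieSubmodule.nontrivial_iff_ne_bot ℂ _ L).2 h
  refine LieModule.IsIrreducible.mk fun W hW ↦ ?_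
  set W' : LieSubmodule ℂ (deletion X d) L := W.map (piece X d i).incl
  have hW'i : W'.toSubmodule ≤ pieceSpan b d i := LieSubmodule.map_incl_le
  -- The elements of `L` sending `y` into `W'` form a subspace; it contains the coweight, which
  -- scales `y`, and the `H_j` with `j ≠ d`, hence all of `H`.
  have hH (y : L) (hy : y ∈ W') : ∀ x ∈ H, ⁅x, y⁆ ∈ W' := by
    let S : Submodule ℂ L := W'.toSubmodule.comap
      ((LieModule.toEnd ℂ L L : L →ₗ[ℂ] Module.End ℂ L).flip y)
    refine cartan_le_of_coweight_mem X (N := S) (d := d) ?_ fun j hj ↦ ?_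
    · change ⁅(coweight b d : L), y⁆ ∈ W'
      rw [coweight_lie_of_mem_pieceSpan (hW'i hy)]
      exact W'.smul_mem _ hy
    · exact W'.lie_mem (x := ⟨X.Hgen j, Hgen_mem_deletion hj⟩) hy
  let N : LieSubmodule ℂ H L :=
    { W'.toSubmodule with lie_mem := fun {x y} hy ↦ hH y hy x x.2 }
  have hN : N ≠ ⊥ := fun hN ↦ hW <| by
    have h1 : W' = ⊥ := LieSubmodule.toSubmodule_injective
      (congrArg LieSubmodule.toSubmodule hN : N.toSubmodule = _)
    rw [eq_bot_iff]
    intro x hx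
    have h2 : (x : L) ∈ W' := LieSubmodule.mem_map_of_mem hx
    rw [h1, LieSubmodule.mem_bot] at h2
    simpa using h2
  have hall : pieceSpan b d i ≤ W'.toSubmodule := by
    refine Submodule.span_le.2 fun x hx ↦ ?_
    rcases hx with ⟨α, hα, hx⟩ | ⟨h0, -⟩
    · exact rootSpace_le_of_lie_stable X hi N hN hW'i
        (fun x hx y hy ↦ W'.lie_mem (x := ⟨x, hx⟩) hy) hα hx
    · exact absurd h0 hi
  refine eq_top_iff.2 fun x _ ↦ ?_
  obtain ⟨y, hy, hyx⟩ := (LieSubmodule.mem_map _).1 (hall x.2)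
  rwa [← Subtype.ext hyx]

/-! ### The trivial complement in degree zero -/

lemma lie_coweight_eq_zero (x : deletion X d) : ⁅x, (coweight b d : L)⁆ = 0 := by
  rw [LieSubalgebra.coe_bracket_of_module, ← lie_skew,
    coweight_lie_of_mem_pieceSpan (mem_pieceSpan_zero_of_mem_deletion x.2)]
  simp

/-- The line through the coweight at `d`, on which the deletion acts trivially. -/
def coweightLine (X : WeylGenerators b) (d : b.support) : LieSubmodule ℂ (deletion X d) L where
  __ := Submodule.span ℂ {(coweight b d : L)}
  lie_mem {x y} hy := by
    obtain ⟨c, rfl⟩ := Submodule.mem_span_singleton.1 hy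
    rw [lie_smul, lie_coweight_eq_zero, smul_zero]
    exact Submodule.zero_mem _

lemma lie_eq_zero_of_mem_coweightLine (x : deletion X d) {y : L} (hy : y ∈ coweightLine X d) :
    ⁅x, y⁆ = 0 := by
  obtain ⟨c, rfl⟩ := Submodule.mem_span_singleton.1 hy
  rw [lie_smul, lie_coweight_eq_zero, smul_zero]

lemma coe_coweight_ne_zero : (coweight b d : L) ≠ 0 := fun h ↦
  killingForm_coweight_self_ne_zero (b := b) (d := d) (by simp [h])

/-- The line through the coweight is a one-dimensional trivial module. -/
def coweightLineEquiv (X : WeylGenerators b) (d : b.support) :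
    coweightLine X d ≃ₗ⁅ℂ, deletion X d⁆ TrivialLieModule ℂ (deletion X d) ℂ where
  __ := ((LinearEquiv.toSpanNonzeroSingleton ℂ L _ (coe_coweight_ne_zero (b := b) (d := d))).symm
    |>.trans (TrivialLieModule.equiv ℂ (deletion X d) ℂ).symm :
      (coweightLine X d).toSubmodule ≃ₗ[ℂ] TrivialLieModule ℂ (deletion X d) ℂ)
  map_lie' {x m} := by
    have : ⁅x, m⁆ = 0 := Subtype.ext (lie_eq_zero_of_mem_coweightLine x m.2)
    rw [this, trivial_lie_zero]
    exact map_zero ((LinearEquiv.toSpanNonzeroSingleton ℂ L _ _).symm.trans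
      (TrivialLieModule.equiv ℂ (deletion X d) ℂ).symm)

lemma disjoint_deletion_coweightLine (X : WeylGenerators b) (d : b.support) :
    Disjoint (deletion X d).toLieSubmodule (coweightLine X d) := by
  rw [disjoint_iff, eq_bot_iff]
  rintro x ⟨hx, hx'⟩
  obtain ⟨c, rfl⟩ := Submodule.mem_span_singleton.1 hx'
  have := killingForm_coweight_of_mem_deletion (X := X) (d := d) hx
  rw [map_smul, smul_eq_mul, mul_eq_zero,
    or_iff_left killingForm_coweight_self_ne_zero] at this
  simp [this]

lemma deletion_sup_coweightLine (X : WeylGenerators b) (d : b.support) :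
    (deletion X d).toLieSubmodule ⊔ coweightLine X d = piece X d 0 := by
  have hz : (coweight b d : L) ∈ coweightLine X d := Submodule.mem_span_singleton_self _
  refine le_antisymm (sup_le (fun x hx ↦ mem_pieceSpan_zero_of_mem_deletion hx) ?_) ?_
  · exact (Submodule.span_singleton_le_iff_mem _ _).2
      (Submodule.subset_span (.inr ⟨rfl, SetLike.coe_mem _⟩))
  · set N := (deletion X d).toLieSubmodule ⊔ coweightLine X d
    have hN : ∀ x ∈ deletion X d, x ∈ N.toSubmodule := fun x hx ↦
      (le_sup_left : (deletion X d).toLieSubmodule ≤ N) hx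
    have hle : pieceSpan b d 0 ≤ N.toSubmodule := by
      refine Submodule.span_le.2 fun x hx ↦ ?_
      rcases hx with ⟨α, hα, hx⟩ | ⟨-, hx⟩
      · exact hN x (rootSpace_le_deletion X hα hx)
      · exact cartan_le_of_coweight_mem X ((le_sup_right : coweightLine X d ≤ N) hz)
          (fun j hj ↦ hN _ (Hgen_mem_deletion hj)) hx
    exact hle

end RootGrading

end

theorem proposition3p2 {L : Type*} [LieRing L] [LieAlgebra ℂ L] [FiniteDimensional ℂ L]
    [LieAlgebra.IsSimple ℂ L] (H : LieSubalgebra ℂ L) [H.IsCartanSubalgebra]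
    (b : (LieAlgebra.IsKilling.rootSystem H).Base) (X : RootGrading.WeylGenerators b)
    (d : b.support) :
    (∀ i : ℤ, i ≠ 0 → RootGrading.piece X d i ≠ ⊥ →
      LieModule.IsIrreducible ℂ (RootGrading.deletion X d) (RootGrading.piece X d i)) ∧
    ∃ Z : LieSubmodule ℂ (RootGrading.deletion X d) L,
      Nonempty (Z ≃ₗ⁅ℂ, RootGrading.deletion X d⁆
        TrivialLieModule ℂ (RootGrading.deletion X d) ℂ) ∧
      Disjoint (RootGrading.deletion X d).toLieSubmodule Z ∧
      (RootGrading.deletion X d).toLieSubmodule ⊔ Z = RootGrading.piece X d 0 :=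
  ⟨fun _ hi h ↦ RootGrading.isIrreducible_piece X d hi h,
    RootGrading.coweightLine X d, ⟨RootGrading.coweightLineEquiv X d⟩,
    RootGrading.disjoint_deletion_coweightLine X d, RootGrading.deletion_sup_coweightLine X d⟩
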